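/- **Definitions.** Let $n\ge 0$, $k\ge 1$, let $U\subset\mathbb R^n$ be open and let $\omega:U\to\Lambda^{k-1}(\mathbb R^n)^*$ be a $(k-1)$-form on $U$ (no regularity assumed). A *$k$-block* is a product $B=\prod_{i=1}^k[a_{i0},a_{i1}]\subset\mathbb R^k$ with $a_{i0}<a_{i1}$; $L(B)$ and $l(B)$ are the lengths of its longest and shortest sides. For a $(k-1)$-form $\eta$ defined on a neighbourhood of $B$ put $$\int_{\partial B}\eta=\sum_{i=1}^k\sum_{j=0}^1(-1)^{i+j}\int_{\prod_{l\ne i}[a_{l0},a_{l1}]}c_{ij}^*\eta,$$ where $c_{ij}$ inserts the constant $a_{ij}$ as the $i$-th coordinate and the integrals are Riemann integrals (evaluation at the point, if $k=1$); $\eta$ is *integrable over $\partial B$* if all these integrals exist. The form $\omega$ is *flux-integrable around $x\in U$* if for every open $A\subset\mathbb R^k$, every $C^1$ map $\varphi:A\to U$, every $p\in A$ with $\varphi(p)=x$ and every $k$-block $B\subset A$ with $p\in B$, the pullback $\varphi^*\omega$ is integrable over $\partial B$. The form $\omega$ is *derivable at $x\in U$ (in the flux sense)* if it is flux-integrable around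 $x$ and there is a $k$-form $\mathrm D\omega_x\in\Lambda^k(\mathbb R^n)^*$ such that for all $v_1,\dots,v_k\in\mathbb R^n$ and every $C^1$ map $\varphi:A\to U$ on an open set $A\subset\mathbb R^k$ with $p\in A$, $\varphi(p)=x$ and $\varphi'(p)e_i=v_i$ for $i=1,\dots,k$: for every $\varepsilon>0$ and every $K>1$ there is $\delta>0$ such that $$\left|\mathrm D\omega_x(v_1,\dots,v_k)-\frac1{\mathrm{vol}(B)}\int_{\partial B}\varphi^*\omega\right|<\varepsilon$$ for every $k$-block $B\subset A$ with $p\in B$, $L(B)<\delta$ and $L(B)/l(B)<K$. Such a $\mathrm D\omega_x$ is called an *exterior derivative of $\omega$ at $x$ in the flux sense*. If $\omega$ is (Fréchet) differentiable at $x$ with derivative $\omega'(x)$, its usual exterior derivative is $\mathrm d\omega_x(v_1,\dots,v_k)=\sum_{i=1}^k(-1)^{i+1}\,\omega'(x)v_i\,(v_1,\dots,\widehat{v_i},\dots,v_k)$. **Theorem ($\mathrm D=\mathrm d$ in the differentiable case).** Let $\omega$ be a $(k-1)$-form on an open set $U\subset\mathbb R^n$, and let $x_0\in U$. Suppose that $\omega$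 is flux-integrable around $x_0$ and differentiable at $x_0$. Then $\omega$ is derivable at $x_0$ in the flux sense, its exterior derivative $\mathrm D\omega_{x_0}$ in the flux sense is unique, and $$\mathrm D\omega_{x_0}=\mathrm d\omega_{x_0}.$$ -/

import Mathlib

open scoped Topology

noncomputable section

namespace Flux

/-- `ℝⁿ` with its Euclidean norm, the space in which forms live. -/
abbrev Eucl (n : ℕ) : Type := EuclideanSpace ℝ (Fin n)

/-- Differential `k`-forms on `V`, without any regularity assumption. A form on an open set `U`
is represented by a total function of which only the values on `U` are ever used. -/
abbrev Form (V : Type*) [NormedAddCommGroup V] [NormedSpace ℝ V] (k : ℕ) : Type _ :=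
  V → V [⋀^Fin k]→L[ℝ] ℝ

/-- The pullback `(φ^*ω)_t (w₁, …, w_k) = ω_{φ t} (φ'(t) w₁, …, φ'(t) w_k)`. -/
def pullback {V W : Type*} [NormedAddCommGroup V] [NormedSpace ℝ V]
    [NormedAddCommGroup W] [NormedSpace ℝ W] {k : ℕ} (φ : V → W) (ω : Form W k) : Form V k :=
  fun t => (ω (φ t)).compContinuousLinearMap (fderiv ℝ φ t)

/-- A `k`-block is a product of nondegenerate closed intervals `[a_i, b_i]`; it is represented by
its corners, that is by `B : BoxIntegral.Box (Fin k)`, the block itself being the set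
`BoxIntegral.Box.Icc B`. -/
abbrev Block (k : ℕ) : Type := BoxIntegral.Box (Fin k)

/-- The function `f` in `η = f dx¹ ∧ ⋯ ∧ dxᵏ`, for a `k`-form `η` on `ℝᵏ`. -/
def coeff {k : ℕ} (η : Form (Fin k → ℝ) k) (t : Fin k → ℝ) : ℝ :=
  η t (fun i => Pi.single i 1)

/-- Riemann integrability of a `k`-form over a `k`-block of `ℝᵏ`. -/
def BlockIntegrable {k : ℕ} (B : Block k) (η : Form (Fin k → ℝ) k) : Prop :=
  BoxIntegral.Integrable B BoxIntegral.IntegrationParams.Riemann (coeff η)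
    (MeasureTheory.volume : MeasureTheory.Measure (Fin k → ℝ)).toBoxAdditive.toSMul

/-- The Riemann integral of a `k`-form over a `k`-block of `ℝᵏ`. -/
def blockIntegral {k : ℕ} (B : Block k) (η : Form (Fin k → ℝ) k) : ℝ :=
  BoxIntegral.integral B BoxIntegral.IntegrationParams.Riemann (coeff η)
    (MeasureTheory.volume : MeasureTheory.Measure (Fin k → ℝ)).toBoxAdditive.toSMul

/-- The map `(t₁, …, t_m) ↦ (t₁, …, a, …, t_m)` with `a` inserted in position `i`. -/
def faceMap {m : ℕ} (i : Fin (m + 1)) (a : ℝ) (t : Fin m → ℝ) : Fin (m + 1) → ℝ :=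
  i.insertNth a t

/-- The `m`-form `η` on `ℝ^(m+1)` is integrable over the boundary of the block `B`: its pullback to
each of the `2(m+1)` faces is Riemann integrable. -/
def BoundaryIntegrable {m : ℕ} (B : Block (m + 1)) (η : Form (Fin (m + 1) → ℝ) m) : Prop :=
  ∀ i : Fin (m + 1),
    BlockIntegrable (B.face i) (pullback (faceMap i (B.lower i)) η) ∧
    BlockIntegrable (B.face i) (pullback (faceMap i (B.upper i)) η)

/-- The integral of the `m`-form `η` over the oriented boundary of `B`. Coordinates are numbered
from `0`, so the upper face (`j = 1`) in coordinate `i` has sign `(-1)^((i+1)+1) = (-1)^i`, and the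
lower face (`j = 0`) has the opposite sign. -/
def boundaryIntegral {m : ℕ} (B : Block (m + 1)) (η : Form (Fin (m + 1) → ℝ) m) : ℝ :=
  ∑ i : Fin (m + 1), (-1 : ℝ) ^ (i : ℕ) *
    (blockIntegral (B.face i) (pullback (faceMap i (B.upper i)) η) -
      blockIntegral (B.face i) (pullback (faceMap i (B.lower i)) η))

/-- The length of the longest side of `B`. -/
def longSide {m : ℕ} (B : Block (m + 1)) : ℝ := ⨆ i, (B.upper i - B.lower i)

/-- The length of the shortest side of `B`. -/
def shortSide {m : ℕ} (B : Block (m + 1)) : ℝ := ⨅ i, (B.upper i - B.lower i)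

/-- The volume of `B`. -/
def vol {m : ℕ} (B : Block (m + 1)) : ℝ := ∏ i, (B.upper i - B.lower i)

/-- `φ : A → U` is a `C¹` map on the open set `A`, with `p ∈ A` and `φ p = x`. -/
structure IsParamAt {n m : ℕ} (U : Set (Eucl n)) (x : Eucl n) (A : Set (Fin (m + 1) → ℝ))
    (φ : (Fin (m + 1) → ℝ) → Eucl n) (p : Fin (m + 1) → ℝ) : Prop where
  isOpen : IsOpen A
  contDiffOn : ContDiffOn ℝ 1 φ A
  mapsTo : Set.MapsTo φ A U
  mem : p ∈ A
  map_eq : φ p = x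

/-- Flux-integrability around `x` of the `m`-form `ω` on `U`: for every `C¹` map `φ : A → U` with
`φ p = x` and every block `B ⊆ A` containing `p`, the form `φ^*ω` is integrable over `∂B`. -/
def FluxIntegrableAt {n m : ℕ} (U : Set (Eucl n)) (ω : Form (Eucl n) m) (x : Eucl n) : Prop :=
  ∀ (A : Set (Fin (m + 1) → ℝ)) (φ : (Fin (m + 1) → ℝ) → Eucl n) (p : Fin (m + 1) → ℝ),
    IsParamAt U x A φ p →
    ∀ B : Block (m + 1), BoxIntegral.Box.Icc B ⊆ A → p ∈ BoxIntegral.Box.Icc B →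
      BoundaryIntegrable B (pullback φ ω)

/-- `g B → c` as the block `B ⊆ A` containing `p` shrinks to `p` with bounded eccentricity. -/
def BlockTendsto {m : ℕ} (A : Set (Fin (m + 1) → ℝ)) (p : Fin (m + 1) → ℝ)
    (g : Block (m + 1) → ℝ) (c : ℝ) : Prop :=
  ∀ ε : ℝ, 0 < ε → ∀ K : ℝ, 1 < K → ∃ δ : ℝ, 0 < δ ∧
    ∀ B : Block (m + 1), BoxIntegral.Box.Icc B ⊆ A → p ∈ BoxIntegral.Box.Icc B →
      longSide B < δ → longSide B / shortSide B < K → |c - g B| < ε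

/-- `η` is an exterior derivative of the `m`-form `ω` at `x` in the flux sense: `ω` is
flux-integrable around `x` and, for all `v`, `η (v)` is the limit of `vol(B)⁻¹ ∫_{∂B} φ^*ω` for
every `C¹` map `φ : A → U` with `φ p = x` and `φ'(p) e_i = v_i`. -/
def IsFluxDerivAt {n m : ℕ} (U : Set (Eucl n)) (ω : Form (Eucl n) m) (x : Eucl n)
    (η : Eucl n [⋀^Fin (m + 1)]→L[ℝ] ℝ) : Prop :=
  FluxIntegrableAt U ω x ∧
  ∀ (v : Fin (m + 1) → Eucl n) (A : Set (Fin (m + 1) → ℝ)) (φ : (Fin (m + 1) → ℝ) → Eucl n)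
    (p : Fin (m + 1) → ℝ), IsParamAt U x A φ p →
    (∀ i, fderiv ℝ φ p (Pi.single i 1) = v i) →
    BlockTendsto A p (fun B => (1 / vol B) * boundaryIntegral B (pullback φ ω)) (η v)

/-- `ω` is derivable at `x` in the flux sense. -/
def DerivableAt {n m : ℕ} (U : Set (Eucl n)) (ω : Form (Eucl n) m) (x : Eucl n) : Prop :=
  ∃ η : Eucl n [⋀^Fin (m + 1)]→L[ℝ] ℝ, IsFluxDerivAt U ω x η

end Flux

end

/-! ### Smooth approximation of `C¹` maps. -/

namespace Flux

open Set Metric Filter MeasureTheory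
open scoped ContDiff Convolution

/-! Near `p`, split `φ^*ω` into the pullback of the constant form `ω(x₀)`, a part `H` linear in `s -
p`, and a remainder. Although `φ'` is only continuous, `ω ∘ φ - ω(x₀)` vanishes at `p`, so its
pullback is differentiable there and the remainder is `o(‖s - p‖)`. The constant form contributes
nothing: its pullback by a smooth map is closed, and a `C¹` map is a `C¹` limit of smooth ones
(`boundaryIntegral_pullback_const`). By Stokes, `H` contributes exactly `vol B * dω(v)`. The faces
have total volume at most `2(m+1) vol B / l(B)`, so the remainder contributes `o(L(B)) vol B /
l(B)`, which is `o(vol B)` because `L(B)/l(B) < K`. Uniqueness holds because affine maps realise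
every frame `v`. -/

/-- A `C¹` function on an open set can be approximated in `C¹`, uniformly on a compact subset, by
smooth functions on the whole space. -/
theorem exists_contDiff_norm_fderiv_sub_le {E F : Type*} [NormedAddCommGroup E] [NormedSpace ℝ E]
    [FiniteDimensional ℝ E] [NormedAddCommGroup F] [NormedSpace ℝ F] [CompleteSpace F]
    {A K : Set E} {φ : E → F} (hA : IsOpen A) (hφ : ContDiffOn ℝ 1 φ A) (hK : IsCompact K)
    (hKA : K ⊆ A) {ε : ℝ} (hε : 0 < ε) :
    ∃ ψ : E → F, ContDiff ℝ ∞ ψ ∧ ∀ x ∈ K, ‖fderiv ℝ ψ x - fderiv ℝ φ x‖ ≤ ε := by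
  have := FiniteDimensional.proper_real E
  obtain ⟨r, hr, hrA⟩ := hK.exists_cthickening_subset_open hA hKA
  -- The cutoff equals `1` on a whole neighbourhood of `K`, so `χ • φ` has the derivative of `φ` on
  -- `K`; its support stays inside `A`, so it is globally `C¹`.
  obtain ⟨χ, hχ, -, hsupp, hone⟩ := exists_contMDiff_support_eq_eq_one_iff (n := ⊤)
    (modelWithCornersSelf ℝ E) (isOpen_thickening (δ := r) (E := K))
    (isClosed_cthickening (δ := r / 2) (E := K))
    (cthickening_subset_thickening' hr (half_lt_self hr) K)
  rw [contMDiff_iff_contDiff] at hχ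
  have hts : tsupport χ ⊆ cthickening r K := by
    rw [tsupport, hsupp]
    exact closure_thickening_subset_cthickening r K
  set g : E → F := fun x => χ x • φ x with hg
  have hgts : tsupport g ⊆ cthickening r K := (tsupport_smul_subset_left χ φ).trans hts
  have hgc : ContDiff ℝ 1 g := by
    rw [contDiff_iff_contDiffAt]
    intro x
    by_cases hx : x ∈ A
    · exact (hχ.contDiffAt.of_le (by exact_mod_cast le_top)).smul (hφ.contDiffAt (hA.mem_nhds hx))
    · have : g =ᶠ[𝓝 x] fun _ => 0 :=
        notMem_tsupport_iff_eventuallyEq.mp fun h => hx (hrA (hgts h))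
      exact contDiffAt_const.congr_of_eventuallyEq this
  have hcs : HasCompactSupport g :=
    (hK.cthickening).of_isClosed_subset (isClosed_tsupport _) hgts
  have hgK : ∀ x ∈ K, fderiv ℝ g x = fderiv ℝ φ x := by
    intro x hx
    refine Filter.EventuallyEq.fderiv_eq ?_
    filter_upwards [isOpen_thickening.mem_nhds (self_subset_thickening (half_pos hr) K hx)]
      with y hy
    simp [hg, (hone y).1 (thickening_subset_cthickening _ _ hy)]
  have huc : UniformContinuous (fderiv ℝ g) :=
    (hcs.fderiv ℝ).uniformContinuous_of_continuous (hgc.continuous_fderiv one_ne_zero)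
  obtain ⟨δ, hδ, hfδ⟩ := Metric.uniformContinuous_iff.mp huc ε hε
  borelize E
  let μ : Measure E := Measure.addHaar
  let b : ContDiffBump (0 : E) := ⟨δ / 2, δ, half_pos hδ, half_lt_self hδ⟩
  -- Mollify: the derivative of the convolution is the bump-average of `fderiv ℝ g`, which varies by
  -- less than `ε` over the bump radius `δ`.
  refine ⟨b.normed μ ⋆[ContinuousLinearMap.lsmul ℝ ℝ, μ] g, ?_, fun x hx => ?_⟩
  · exact b.hasCompactSupport_normed.contDiff_convolution_left _ b.contDiff_normed
      hgc.continuous.locallyIntegrable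
  · have hb : LocallyIntegrable (b.normed μ) μ :=
      (b.contDiff_normed (n := 0)).continuous.locallyIntegrable
    rw [(hcs.hasFDerivAt_convolution_right (ContinuousLinearMap.lsmul ℝ ℝ) hb hgc x).fderiv,
      ← hgK x hx, ← dist_eq_norm]
    have key : (b.normed μ ⋆[(ContinuousLinearMap.lsmul ℝ ℝ).precompR E, μ] fderiv ℝ g) x =
        (b.normed μ ⋆[ContinuousLinearMap.lsmul ℝ ℝ, μ] fderiv ℝ g) x := rfl
    rw [key]
    refine b.dist_normed_convolution_le
      (hgc.continuous_fderiv one_ne_zero).aestronglyMeasurable fun y hy => (hfδ hy).le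

end Flux

/-! ### Face integrals, Stokes' theorem on a block, and products with a vanishing factor. -/

namespace Flux

open Set MeasureTheory Asymptotics
open ContinuousAlternatingMap

section Face

variable {m : ℕ} {B : Block (m + 1)} {η η' : Form (Fin (m + 1) → ℝ) m}

/-- The standard basis of `ℝ^(m+1)`. -/
abbrev stdFrame (m : ℕ) : Fin (m + 1) → Fin (m + 1) → ℝ := fun i => Pi.single i 1

theorem hasFDerivAt_faceMap (i : Fin (m + 1)) (a : ℝ) (t : Fin m → ℝ) :
    HasFDerivAt (faceMap i a)
      (ContinuousLinearMap.pi (i.insertNth (α := fun _ => (Fin m → ℝ) →L[ℝ] ℝ) 0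
        fun j => ContinuousLinearMap.proj j)) t := by
  rw [hasFDerivAt_pi']
  intro j
  cases j using i.succAboveCases with
  | x =>
    simp only [faceMap, Fin.insertNth_apply_same]
    refine (hasFDerivAt_const a t).congr_fderiv ?_
    ext; simp
  | p j =>
    simp only [faceMap, Fin.insertNth_apply_succAbove]
    refine (hasFDerivAt_apply j t).congr_fderiv ?_
    ext; simp

/-- The standard frame of the face in direction `i`. -/
theorem fderiv_faceMap_single (i : Fin (m + 1)) (a : ℝ) (t : Fin m → ℝ) (j : Fin m) :
    fderiv ℝ (faceMap i a) t (Pi.single j 1) = Pi.single (i.succAbove j) 1 := by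
  rw [(hasFDerivAt_faceMap i a t).fderiv]
  ext l
  cases l using i.succAboveCases <;> simp [Pi.single_apply]

/-- Turns a face integrand into evaluation on a fixed frame, so that continuity and norm bounds pass
through a fixed linear functional. -/
theorem coeff_pullback_faceMap (i : Fin (m + 1)) (a : ℝ) (η : Form (Fin (m + 1) → ℝ) m) :
    coeff (pullback (faceMap i a) η) = fun t =>
      η (i.insertNth a t) (i.removeNth (stdFrame m)) := by
  ext t
  simp only [coeff, pullback, compContinuousLinearMap_apply]
  congr 1
  ext1 j
  simp [stdFrame, Fin.removeNth, fderiv_faceMap_single]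

theorem BoundaryIntegrable.of_continuousOn (h : ContinuousOn η (BoxIntegral.Box.Icc B)) :
    BoundaryIntegrable B η := by
  have key (i : Fin (m + 1)) {a : ℝ} (ha : a ∈ Icc (B.lower i) (B.upper i)) :
      BlockIntegrable (B.face i) (pullback (faceMap i a) η) := by
    refine BoxIntegral.integrable_of_continuousOn _ ?_ _
    rw [coeff_pullback_faceMap]
    exact (apply ℝ _ ℝ (i.removeNth (stdFrame m))).continuous.comp_continuousOn
      (B.continuousOn_face_Icc h ha)
  exact fun i => ⟨key i (left_mem_Icc.2 (B.lower_le_upper i)),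
    key i (right_mem_Icc.2 (B.lower_le_upper i))⟩

theorem coeff_pullback_add {V : Type*} [NormedAddCommGroup V] [NormedSpace ℝ V]
    (φ : (Fin m → ℝ) → V) (η η' : Form V m) :
    coeff (pullback φ (η + η')) = coeff (pullback φ η) + coeff (pullback φ η') := rfl

theorem coeff_pullback_sub {V : Type*} [NormedAddCommGroup V] [NormedSpace ℝ V]
    (φ : (Fin m → ℝ) → V) (η η' : Form V m) :
    coeff (pullback φ (η - η')) = coeff (pullback φ η) - coeff (pullback φ η') := rfl

theorem boundaryIntegral_add (h : BoundaryIntegrable B η) (h' : BoundaryIntegrable B η') :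
    boundaryIntegral B (η + η') = boundaryIntegral B η + boundaryIntegral B η' := by
  simp only [boundaryIntegral, ← Finset.sum_add_distrib]
  refine Finset.sum_congr rfl fun i _ => ?_
  simp only [blockIntegral, coeff_pullback_add]
  rw [BoxIntegral.integral_add (h i).1 (h' i).1, BoxIntegral.integral_add (h i).2 (h' i).2]
  ring

theorem boundaryIntegral_sub (h : BoundaryIntegrable B η) (h' : BoundaryIntegrable B η') :
    boundaryIntegral B (η - η') = boundaryIntegral B η - boundaryIntegral B η' := by
  simp only [boundaryIntegral, ← Finset.sum_sub_distrib]
  refine Finset.sum_congr rfl fun i _ => ?_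
  simp only [blockIntegral, coeff_pullback_sub]
  rw [BoxIntegral.integral_sub (h i).1 (h' i).1, BoxIntegral.integral_sub (h i).2 (h' i).2]
  ring

/-- The frame vectors have sup norm `1`, and each direction has two faces. Integrability is not
needed, since a nonexistent integral has default value `0`. -/
theorem abs_boundaryIntegral_le {c : ℝ} (h : ∀ s ∈ BoxIntegral.Box.Icc B, ‖η s‖ ≤ c) :
    |boundaryIntegral B η| ≤
      ∑ i, 2 * (c * ∏ j, ((B.face i).upper j - (B.face i).lower j)) := by
  have key (i : Fin (m + 1)) {a : ℝ} (ha : a ∈ Icc (B.lower i) (B.upper i)) :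
      |blockIntegral (B.face i) (pullback (faceMap i a) η)| ≤
        c * ∏ j, ((B.face i).upper j - (B.face i).lower j) := by
    rw [← BoxIntegral.Box.volume_apply', mul_comm]
    refine BoxIntegral.norm_integral_le_of_le_const (E := ℝ) (fun t ht => ?_)
      (volume : Measure (Fin m → ℝ))
    rw [coeff_pullback_faceMap]
    refine (le_opNorm _ _).trans ?_
    simpa [stdFrame, Fin.removeNth, Pi.norm_single] using h _ (B.mapsTo_insertNth_face_Icc ha ht)
  refine (Finset.abs_sum_le_sum_abs _ _).trans (Finset.sum_le_sum fun i _ => ?_)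
  rw [abs_mul, abs_pow, abs_neg, abs_one, one_pow, one_mul, two_mul]
  exact (abs_sub _ _).trans (add_le_add (key i (right_mem_Icc.2 (B.lower_le_upper i)))
    (key i (left_mem_Icc.2 (B.lower_le_upper i))))

theorem blockIntegral_pullback_faceMap (hη : ContinuousOn η (BoxIntegral.Box.Icc B))
    (i : Fin (m + 1)) {a : ℝ} (ha : a ∈ Icc (B.lower i) (B.upper i)) :
    blockIntegral (B.face i) (pullback (faceMap i a) η) =
      ∫ t in BoxIntegral.Box.Icc (B.face i), η (i.insertNth a t) (i.removeNth (stdFrame m)) := by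
  -- Box integrals live on half-open boxes, which differ from the closed ones by a null set.
  rw [blockIntegral, coeff_pullback_faceMap,
    ← setIntegral_congr_set (B.face i).coe_ae_eq_Icc]
  have hc : ContinuousOn (fun t => η (i.insertNth a t) (i.removeNth (stdFrame m)))
      (BoxIntegral.Box.Icc (B.face i)) :=
    (apply ℝ _ ℝ (i.removeNth (stdFrame m))).continuous.comp_continuousOn
      (B.continuousOn_face_Icc hη ha)
  exact (ContinuousOn.hasBoxIntegral (volume : Measure (Fin m → ℝ)) hc
    BoxIntegral.IntegrationParams.Riemann).integral_eq

/-- **Stokes' theorem** on a block for differentiable forms with integrable exterior derivative. -/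
theorem boundaryIntegral_eq_integral_extDeriv (hη : Differentiable ℝ η)
    (hint : IntegrableOn (fun s => extDeriv η s (stdFrame m)) (BoxIntegral.Box.Icc B)) :
    boundaryIntegral B η =
      ∫ s in BoxIntegral.Box.Icc B, extDeriv η s (stdFrame m) := by
  -- The vector field whose divergence is the coefficient of `dη`; the sign is the orientation of
  -- the faces in direction `i`.
  let f : Fin (m + 1) → (Fin (m + 1) → ℝ) → ℝ := fun i s =>
    (-1 : ℝ) ^ (i : ℕ) * η s (i.removeNth (stdFrame m))
  have hη' (i : Fin (m + 1)) : Differentiable ℝ fun s => η s (i.removeNth (stdFrame m)) :=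
    (apply ℝ _ ℝ (i.removeNth (stdFrame m))).differentiable.comp hη
  have hf (i) : Differentiable ℝ (f i) := (hη' i).const_mul _
  have hdiv (s) : extDeriv η s (stdFrame m) = ∑ i, fderiv ℝ (f i) s (Pi.single i 1) := by
    rw [extDeriv_apply (hη s)]
    refine Finset.sum_congr rfl fun i _ => ?_
    simp [f, fderiv_const_mul (hη' i s), zsmul_eq_mul]
  have hc : ContinuousOn η (BoxIntegral.Box.Icc B) := hη.continuous.continuousOn
  simp only [hdiv] at hint ⊢
  refine .trans ?_ (integral_divergence_of_hasFDerivAt_off_countable' B.lower B.upper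
    B.lower_le_upper f (fun i => fderiv ℝ (f i)) ∅ countable_empty
    (fun i => (hf i).continuous.continuousOn) (fun s _ i => (hf i s).hasFDerivAt) hint).symm
  refine Finset.sum_congr rfl fun i _ => ?_
  rw [blockIntegral_pullback_faceMap hc i (right_mem_Icc.2 (B.lower_le_upper i)),
    blockIntegral_pullback_faceMap hc i (left_mem_Icc.2 (B.lower_le_upper i)), mul_sub]
  simp only [f, integral_const_mul]
  rfl

end Face

/-- If `f` vanishes and is differentiable at `p` and `G` is merely continuous at `p`, then
`s ↦ G s (f s)` is differentiable at `p`. -/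
theorem hasFDerivAt_clm_apply_of_eq_zero {V X Y : Type*} [NormedAddCommGroup V] [NormedSpace ℝ V]
    [NormedAddCommGroup X] [NormedSpace ℝ X] [NormedAddCommGroup Y] [NormedSpace ℝ Y]
    {f : V → X} {D : V →L[ℝ] X} {G : V → X →L[ℝ] Y} {p : V} (hf : HasFDerivAt f D p)
    (hfp : f p = 0) (hG : ContinuousAt G p) :
    HasFDerivAt (fun s => G s (f s)) (G p ∘L D) p := by
  -- Write `G s (f s) = G p (f s) + (G s - G p) (f s)`; the last term is `o(1) · O(‖s - p‖)`.
  have h1 : (fun s => G p (f s) - G p (D (s - p))) =o[𝓝 p] fun s => s - p := by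
    simpa [hfp] using ((G p).hasFDerivAt.comp p hf).isLittleO
  have h2 : (fun s => (G s - G p) (f s)) =o[𝓝 p] fun s => s - p := by
    refine (isBoundedBilinearMap_apply.isBigO_comp
      (g := fun s => G s - G p) (h := f)).trans_isLittleO ?_
    have hG' : (fun s => ‖G s - G p‖) =o[𝓝 p] fun _ => (1 : ℝ) :=
      (isLittleO_one_iff ℝ).2 (tendsto_iff_norm_sub_tendsto_zero.1 hG)
    have hO : f =O[𝓝 p] fun s => s - p := by simpa [hfp] using hf.isBigO_sub
    simpa using hG'.mul_isBigO hO.norm_norm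
  refine .of_isLittleO ((h1.add h2).congr_left fun s => ?_)
  simp [hfp]

/-- If `f` vanishes and is differentiable at `p` and `g` is merely continuous at `p`, then the
pullback of `f` by `g` is differentiable at `p`. -/
theorem hasFDerivAt_compContinuousLinearMap_of_eq_zero {V W : Type*} [NormedAddCommGroup V]
    [NormedSpace ℝ V] [NormedAddCommGroup W] [NormedSpace ℝ W] {k : ℕ}
    {f : V → W [⋀^Fin k]→L[ℝ] ℝ} {D : V →L[ℝ] W [⋀^Fin k]→L[ℝ] ℝ} {g : V → V →L[ℝ] W} {p : V}
    (hf : HasFDerivAt f D p) (hfp : f p = 0) (hg : ContinuousAt g p) :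
    HasFDerivAt (fun s => (f s).compContinuousLinearMap (g s))
      (compContinuousLinearMapCLM (g p) ∘L D) p :=
  hasFDerivAt_clm_apply_of_eq_zero hf hfp
    ((continuous_compContinuousLinearMapCLM (𝕜 := ℝ) (ι := Fin k) (G := ℝ)).continuousAt.comp hg)

end Flux

/-! ### Boundary integrals of the constant and linear parts; sides of a block. -/

namespace Flux

open Set MeasureTheory Asymptotics Filter
open ContinuousAlternatingMap

/-- The pullback of a constant form under a `C¹` map has vanishing boundary integrals. -/
theorem boundaryIntegral_pullback_const {W : Type*} [NormedAddCommGroup W] [NormedSpace ℝ W]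
    [CompleteSpace W] {m : ℕ} {A : Set (Fin (m + 1) → ℝ)} {φ : (Fin (m + 1) → ℝ) → W}
    {B : Block (m + 1)} (hA : IsOpen A) (hφ : ContDiffOn ℝ 1 φ A)
    (hBA : BoxIntegral.Box.Icc B ⊆ A) (α : W [⋀^Fin m]→L[ℝ] ℝ) :
    boundaryIntegral B (pullback φ fun _ => α) = 0 := by
  let c : ((Fin (m + 1) → ℝ) →L[ℝ] W) → (Fin (m + 1) → ℝ) [⋀^Fin m]→L[ℝ] ℝ :=
    fun T => α.compContinuousLinearMap T
  have hc : Continuous c :=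
    (ContinuousLinearMap.apply ℝ _ α).continuous.comp continuous_compContinuousLinearMapCLM
  have hφ' : ContinuousOn (fderiv ℝ φ) (BoxIntegral.Box.Icc B) :=
    (hφ.continuousOn_fderiv_of_isOpen hA le_rfl).mono hBA
  let S : ℝ := ∑ i, ∏ j, ((B.face i).upper j - (B.face i).lower j)
  have hS : 0 ≤ S := Finset.sum_nonneg fun i _ => Finset.prod_nonneg fun j _ =>
    sub_nonneg.2 ((B.face i).lower_le_upper j)
  have hsmall : ∀ r > 0, |boundaryIntegral B (pullback φ fun _ => α)| ≤ 2 * S * r := by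
    intro r hr
    -- Only `fderiv ℝ φ s` lies in the compact image, so the uniformity needed is one where the
    -- other point, `fderiv ℝ ψ s`, is unrestricted.
    have hunif := (B.isCompact_Icc.image_of_continuousOn hφ').uniformContinuousAt_of_continuousAt
      c (fun T _ => hc.continuousAt) (Metric.dist_mem_uniformity hr)
    obtain ⟨ε, hε, hεr⟩ := Metric.mem_uniformity_dist.1 hunif
    obtain ⟨ψ, hψ, hψφ⟩ := exists_contDiff_norm_fderiv_sub_le hA hφ B.isCompact_Icc hBA
      (half_pos hε)
    have hψ1 : Differentiable ℝ (pullback ψ fun _ => α) := fun s =>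
      (differentiableAt_const α).continuousAlternatingMapCompContinuousLinearMap
        ((hψ.fderiv_right (m := 1) (WithTop.coe_le_coe.2 le_top)).differentiable one_ne_zero s)
    have hext (s) : extDeriv (pullback ψ fun _ => α) s = 0 := by
      refine (extDeriv_pullback (ω := fun _ : W => α) (differentiableAt_const α)
        (hψ.contDiffAt (x := s))
        (by rw [minSmoothness_of_isRCLikeNormedField]; exact WithTop.coe_le_coe.2 le_top)).trans ?_
      ext v
      simp [extDeriv_apply]
    have hzero : boundaryIntegral B (pullback ψ fun _ => α) = 0 := by
      rw [boundaryIntegral_eq_integral_extDeriv hψ1 (by simp [hext])]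
      simp [hext]
    have hiφ : BoundaryIntegrable B (pullback φ fun _ => α) :=
      .of_continuousOn (hc.comp_continuousOn hφ')
    have hiψ : BoundaryIntegrable B (pullback ψ fun _ => α) :=
      .of_continuousOn hψ1.continuous.continuousOn
    have hle := abs_boundaryIntegral_le (B := B) (c := r)
      (η := (pullback φ fun _ => α) - pullback ψ fun _ => α) fun s hs => by
        have := hεr (a := fderiv ℝ φ s) (b := fderiv ℝ ψ s) (by
          rw [dist_comm, dist_eq_norm]; exact (hψφ s hs).trans_lt (half_lt_self hε))
          (mem_image_of_mem _ hs)
        exact (dist_eq_norm (c (fderiv ℝ φ s)) (c (fderiv ℝ ψ s))).symm.trans_le this.le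
    rw [boundaryIntegral_sub hiφ hiψ, hzero, sub_zero] at hle
    refine hle.trans_eq ?_
    rw [← Finset.mul_sum, ← Finset.mul_sum]
    ring
  refine abs_eq_zero.1 (le_antisymm (le_of_forall_pos_le_add fun r hr => ?_) (abs_nonneg _))
  -- The `+ 1` keeps the denominator positive knowing only `0 ≤ S`.
  refine (hsmall (r / (2 * S + 1)) (by positivity)).trans ?_
  rw [zero_add, ← mul_div_assoc, div_le_iff₀ (by positivity)]
  nlinarith

/-- The form is affine in `s`, so its exterior derivative is constant and Stokes gives an exact
value. -/
theorem boundaryIntegral_comp_sub_compContinuousLinearMap {W : Type*} [NormedAddCommGroup W]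
    [NormedSpace ℝ W] {m : ℕ} (B : Block (m + 1)) (D : W →L[ℝ] W [⋀^Fin m]→L[ℝ] ℝ)
    (T : (Fin (m + 1) → ℝ) →L[ℝ] W) (p : Fin (m + 1) → ℝ) :
    boundaryIntegral B (fun s => (D (T (s - p))).compContinuousLinearMap T) =
      vol B * alternatizeUncurryFin D (T ∘ stdFrame m) := by
  let H : (Fin (m + 1) → ℝ) →L[ℝ] (Fin (m + 1) → ℝ) [⋀^Fin m]→L[ℝ] ℝ :=
    compContinuousLinearMapCLM T ∘L D ∘L T
  have hd (s) : HasFDerivAt (fun s => (D (T (s - p))).compContinuousLinearMap T) H s := by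
    have := H.hasFDerivAt.comp s ((hasFDerivAt_id s).sub_const p)
    exact this
  have hext (s) : extDeriv (fun s => (D (T (s - p))).compContinuousLinearMap T) s (stdFrame m) =
      alternatizeUncurryFin D (T ∘ stdFrame m) := by
    rw [extDeriv, (hd s).fderiv, alternatizeUncurryFin_apply, alternatizeUncurryFin_apply]
    rfl
  rw [boundaryIntegral_eq_integral_extDeriv (fun s => (hd s).differentiableAt) (by
    simp only [hext]
    exact integrableOn_const (B.measure_Icc_lt_top volume).ne)]
  simp only [hext]
  rw [setIntegral_const, ← measureReal_congr B.coe_ae_eq_Icc, measureReal_def,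
    BoxIntegral.Box.volume_apply', smul_eq_mul, vol]

section Sides

variable {m : ℕ} (B : Block (m + 1))

theorem side_pos (i : Fin (m + 1)) : 0 < B.upper i - B.lower i :=
  sub_pos.2 (B.lower_lt_upper i)

theorem side_le_longSide (i : Fin (m + 1)) : B.upper i - B.lower i ≤ longSide B :=
  le_ciSup (f := fun i => B.upper i - B.lower i) (finite_range _).bddAbove i

theorem shortSide_le_side (i : Fin (m + 1)) : shortSide B ≤ B.upper i - B.lower i :=
  ciInf_le (f := fun i => B.upper i - B.lower i) (finite_range _).bddBelow i

theorem shortSide_pos : 0 < shortSide B := by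
  obtain ⟨i, hi⟩ := exists_eq_ciInf_of_finite (f := fun i => B.upper i - B.lower i)
  exact (side_pos B i).trans_eq hi

theorem vol_pos : 0 < vol B := Finset.prod_pos fun i _ => side_pos B i

theorem norm_sub_le_longSide {B : Block (m + 1)} {s p : Fin (m + 1) → ℝ}
    (hs : s ∈ BoxIntegral.Box.Icc B) (hp : p ∈ BoxIntegral.Box.Icc B) : ‖s - p‖ ≤ longSide B := by
  refine (pi_norm_le_iff_of_nonempty _).2 fun i => ?_
  refine le_trans ?_ (side_le_longSide B i)
  rw [Pi.sub_apply, Real.norm_eq_abs, abs_le]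
  constructor <;> linarith [hs.1 i, hs.2 i, hp.1 i, hp.2 i]

/-- The volume of a face times the omitted side is `vol B`, and that side is at least `shortSide B`.
-/
theorem sum_vol_face_le :
    ∑ i, ∏ j, ((B.face i).upper j - (B.face i).lower j) ≤ (m + 1) * (vol B / shortSide B) := by
  have key (i : Fin (m + 1)) :
      ∏ j, ((B.face i).upper j - (B.face i).lower j) ≤ vol B / shortSide B := by
    rw [le_div_iff₀ (shortSide_pos B), vol, ← BoxIntegral.Box.volume_face_mul i B]
    exact mul_le_mul_of_nonneg_left (shortSide_le_side B i)
      (Finset.prod_nonneg fun j _ => sub_nonneg.2 ((B.face i).lower_le_upper j))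
  simpa using Finset.sum_le_card_nsmul Finset.univ _ _ fun i _ => key i

end Sides

end Flux

/-! ### Existence and uniqueness of the flux derivative. -/

namespace Flux

open Set MeasureTheory Asymptotics Filter
open ContinuousAlternatingMap

variable {n m : ℕ} {U : Set (Eucl n)} {ω : Form (Eucl n) m} {x₀ : Eucl n}

/-- The first order expansion of `φ^*ω` at `p`, up to the pullback of a constant form: no
differentiability of `φ'` is needed. -/
theorem hasFDerivAt_pullback_sub_const {V W : Type*} [NormedAddCommGroup V] [NormedSpace ℝ V]
    [NormedAddCommGroup W] [NormedSpace ℝ W] {k : ℕ} {ω : Form W k} {φ : V → W} {p : V}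
    (hω : DifferentiableAt ℝ ω (φ p)) (hφ : ContDiffAt ℝ 1 φ p) :
    HasFDerivAt (pullback φ ω - pullback φ fun _ => ω (φ p))
      (compContinuousLinearMapCLM (fderiv ℝ φ p) ∘L fderiv ℝ ω (φ p) ∘L fderiv ℝ φ p) p :=
  hasFDerivAt_compContinuousLinearMap_of_eq_zero
    (f := fun s => ω (φ s) - ω (φ p)) (g := fderiv ℝ φ)
    ((hω.hasFDerivAt.comp p (hφ.differentiableAt one_ne_zero).hasFDerivAt).sub_const _)
    (sub_self _) (hφ.fderiv_right (m := 0) le_rfl).continuousAt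

theorem isFluxDerivAt_extDeriv (hflux : FluxIntegrableAt U ω x₀)
    (hdiff : DifferentiableAt ℝ ω x₀) : IsFluxDerivAt U ω x₀ (extDeriv ω x₀) := by
  refine ⟨hflux, fun v A φ p h hv ε hε K hK => ?_⟩
  obtain ⟨hA, hφ, -, hp, rfl⟩ := id h
  set T := fderiv ℝ φ p
  set D := fderiv ℝ ω (φ p)
  let H : Form (Fin (m + 1) → ℝ) m := fun s => (D (T (s - p))).compContinuousLinearMap T
  let c : Form (Fin (m + 1) → ℝ) m := pullback φ fun _ => ω (φ p)
  -- Two faces in each of `m + 1` directions and the eccentricity bound `K` make the total error `ε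
  -- * vol B`.
  let r : ℝ := ε / (2 * (m + 1) * K)
  have hr : 0 < r := by positivity
  have ho := (hasFDerivAt_pullback_sub_const hdiff
    (hφ.contDiffAt (hA.mem_nhds hp))).isLittleO.def hr
  obtain ⟨δ, hδ, hδr⟩ := Metric.eventually_nhds_iff.1 ho
  refine ⟨δ, hδ, fun B hBA hpB hL hLl => ?_⟩
  have hrem : ∀ s ∈ BoxIntegral.Box.Icc B, ‖(pullback φ ω - (c + H)) s‖ ≤ r * longSide B := by
    intro s hs
    have hsp := norm_sub_le_longSide hs hpB
    refine le_trans (le_of_eq_of_le (congrArg norm ?_)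
      (hδr (dist_eq_norm s p ▸ hsp.trans_lt hL))) (mul_le_mul_of_nonneg_left hsp hr.le)
    have hp0 : (pullback φ ω - pullback φ fun _ => ω (φ p)) p = 0 := sub_self _
    rw [hp0, sub_zero, Pi.sub_apply, Pi.add_apply, ← sub_sub]
    rfl
  have hcint : BoundaryIntegrable B c := by
    refine .of_continuousOn (ContinuousOn.mono ?_ hBA)
    exact ((ContinuousLinearMap.apply ℝ _ (ω (φ p))).continuous.comp
      continuous_compContinuousLinearMapCLM).comp_continuousOn
      (hφ.continuousOn_fderiv_of_isOpen hA le_rfl)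
  have hHint : BoundaryIntegrable B H := by
    refine .of_continuousOn (Continuous.continuousOn ?_)
    exact (compContinuousLinearMapCLM T ∘L D ∘L T).continuous.comp
      (continuous_id.sub continuous_const)
  have hle := abs_boundaryIntegral_le hrem
  have hval : boundaryIntegral B H = vol B * extDeriv ω (φ p) v := by
    rw [boundaryIntegral_comp_sub_compContinuousLinearMap B D T p, extDeriv]
    congr 2
    exact funext hv
  have hcH : BoundaryIntegrable B (c + H) := fun i =>
    ⟨(hcint i).1.add (hHint i).1, (hcint i).2.add (hHint i).2⟩
  rw [boundaryIntegral_sub (hflux A φ p h B hBA hpB) hcH, boundaryIntegral_add hcint hHint,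
    boundaryIntegral_pullback_const hA hφ hBA, zero_add, hval] at hle
  have hvol := vol_pos B
  have hl := shortSide_pos B
  have hLpos : 0 < longSide B := (side_pos B 0).trans_le (side_le_longSide B 0)
  have hlt : |boundaryIntegral B (pullback φ ω) - vol B * extDeriv ω (φ p) v| < ε * vol B := by
    refine hle.trans_lt ?_
    rw [← Finset.mul_sum, ← Finset.mul_sum]
    calc 2 * (r * longSide B * ∑ i, ∏ j, ((B.face i).upper j - (B.face i).lower j))
        ≤ 2 * (r * longSide B * ((m + 1) * (vol B / shortSide B))) := by
          gcongr; exact sum_vol_face_le B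
      _ = 2 * (m + 1) * r * vol B * (longSide B / shortSide B) := by ring
      _ < 2 * (m + 1) * r * vol B * K := by gcongr
      _ = ε * vol B := by simp only [r]; field_simp
  have heq : extDeriv ω (φ p) v - 1 / vol B * boundaryIntegral B (pullback φ ω) =
      -((boundaryIntegral B (pullback φ ω) - vol B * extDeriv ω (φ p) v) / vol B) := by
    field_simp
    ring
  rw [heq, abs_neg, abs_div, abs_of_pos hvol, div_lt_iff₀ hvol]
  exact hlt

/-- Inside a neighbourhood of `p` there are arbitrarily small cubes containing `p`. -/
theorem exists_cube {A : Set (Fin (m + 1) → ℝ)} {p : Fin (m + 1) → ℝ} (hA : A ∈ 𝓝 p) {δ : ℝ}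
    (hδ : 0 < δ) : ∃ B : Block (m + 1), BoxIntegral.Box.Icc B ⊆ A ∧ p ∈ BoxIntegral.Box.Icc B ∧
      longSide B < δ ∧ longSide B / shortSide B = 1 := by
  obtain ⟨r, hr, hrA⟩ := Metric.nhds_basis_closedBall.mem_iff.1 hA
  let d := min r (δ / 2)
  have hd : 0 < d := lt_min hr (half_pos hδ)
  let B : Block (m + 1) := ⟨p, fun i => p i + d, fun i => lt_add_of_pos_right _ hd⟩
  have hside (i) : B.upper i - B.lower i = d := add_sub_cancel_left _ _
  have hlong : longSide B = d := by simp [longSide, hside]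
  have hshort : shortSide B = d := by simp [shortSide, hside]
  have hp : p ∈ BoxIntegral.Box.Icc B := B.lower_mem_Icc
  refine ⟨B, fun s hs => hrA ?_, hp, ?_, ?_⟩
  · rw [mem_closedBall_iff_norm]
    exact (norm_sub_le_longSide hs hp).trans (hlong.trans_le (min_le_left _ _))
  · rw [hlong]
    exact (min_le_right _ _).trans_lt (half_lt_self hδ)
  · rw [hlong, hshort, div_self hd.ne']

/-- Limits are unique because small cubes around `p` are always admissible; their eccentricity `1`
meets the bound `K = 2`. -/
theorem BlockTendsto.unique {A : Set (Fin (m + 1) → ℝ)} {p : Fin (m + 1) → ℝ} (hA : A ∈ 𝓝 p)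
    {g : Block (m + 1) → ℝ} {a b : ℝ} (ha : BlockTendsto A p g a) (hb : BlockTendsto A p g b) :
    a = b := by
  refine eq_of_forall_dist_le fun ε hε => ?_
  obtain ⟨δ, hδ, h⟩ := ha (ε / 2) (half_pos hε) 2 one_lt_two
  obtain ⟨δ', hδ', h'⟩ := hb (ε / 2) (half_pos hε) 2 one_lt_two
  obtain ⟨B, hBA, hpB, hL, hLl⟩ := exists_cube hA (lt_min hδ hδ')
  have h1 := h B hBA hpB (hL.trans_le (min_le_left _ _)) (hLl.trans_lt one_lt_two)
  have h2 := h' B hBA hpB (hL.trans_le (min_le_right _ _)) (hLl.trans_lt one_lt_two)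
  rw [← Real.dist_eq] at h1 h2
  linarith [dist_triangle_right a b (g B)]

theorem IsFluxDerivAt.unique (hU : IsOpen U) (hx₀ : x₀ ∈ U)
    {η η' : Eucl n [⋀^Fin (m + 1)]→L[ℝ] ℝ} (h : IsFluxDerivAt U ω x₀ η)
    (h' : IsFluxDerivAt U ω x₀ η') : η = η' := by
  ext v
  -- The linear map with `e_i ↦ v_i`; the affine map `x₀ + T t` tests both candidates on the
  -- arbitrary frame `v`.
  let T : (Fin (m + 1) → ℝ) →L[ℝ] Eucl n :=
    ∑ i, (ContinuousLinearMap.proj i : (Fin (m + 1) → ℝ) →L[ℝ] ℝ).smulRight (v i)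
  let φ : (Fin (m + 1) → ℝ) → Eucl n := fun t => x₀ + T t
  have hφ : ContDiff ℝ 1 φ := contDiff_const.add T.contDiff
  have hφ0 : φ 0 = x₀ := by simp [φ]
  have hparam : IsParamAt U x₀ (φ ⁻¹' U) φ 0 :=
    ⟨hU.preimage hφ.continuous, hφ.contDiffOn, mapsTo_preimage _ _, by simpa [hφ0] using hx₀, hφ0⟩
  have hderiv (i) : fderiv ℝ φ 0 (Pi.single i 1) = v i := by
    rw [(T.hasFDerivAt.const_add x₀).fderiv]
    simp [T, Pi.single_apply]
  exact BlockTendsto.unique (hparam.isOpen.mem_nhds hparam.mem) (h.2 v _ φ 0 hparam hderiv)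
    (h'.2 v _ φ 0 hparam hderiv)

end Flux

/-- With `k = m + 1`: a `(k-1)`-form `ω` on an open `U ⊆ ℝⁿ` that is flux-integrable around `x₀` and
differentiable at `x₀` is derivable at `x₀`, and its one and only exterior derivative in the flux
sense is the usual `dω_{x₀}`. -/
theorem mainTheorem3 (n m : ℕ) (U : Set (Flux.Eucl n)) (hU : IsOpen U)
    (ω : Flux.Form (Flux.Eucl n) m) (x₀ : Flux.Eucl n) (hx₀ : x₀ ∈ U)
    (hflux : Flux.FluxIntegrableAt U ω x₀)
    (hdiff : DifferentiableAt ℝ ω x₀) :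
    Flux.DerivableAt U ω x₀ ∧
      ∀ η : Flux.Eucl n [⋀^Fin (m + 1)]→L[ℝ] ℝ,
        Flux.IsFluxDerivAt U ω x₀ η ↔ η = extDeriv ω x₀ := by
  have hd := Flux.isFluxDerivAt_extDeriv hflux hdiff
  exact ⟨⟨_, hd⟩, fun η => ⟨fun h => h.unique hU hx₀ hd, fun h => h ▸ hd⟩⟩
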